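/- Let $1\le k$ and $m$ be integers with $k\le\sqrt{m(\log 2)/e}$. Let the $n=\binom m2$ coordinates of a random vector $\mathbf X=(X_e)$ be indexed by the edges of the complete graph $K_m$, and let $\mathcal C$ be the class of the edge sets of all cliques on $k$ vertices of $K_m$ (so each $S\in\mathcal C$ has $\binom k2$ edges, and $N=|\mathcal C|=\binom mk$ when $k\ge2$). For $\mu>0$, let $\mathbb P_0$ be the law of $\mathbf X$ under which the $X_e$ are independent standard normal, and for $S\in\mathcal C$ let $\mathbb P_S$ be the law under which the $X_e$ are independent, with $X_e\sim\mathcal N(\mu,1)$ for $e\in S$ and $X_e\sim\mathcal N(0,1)$ for $e\notin S$; let $\phi_0,\phi_S$ be their Lebesgue densities. The risk of a test $f:\mathbb R^n\to\{0,1\}$ is \[ R(f)=\mathbb P_0\{f(\mathbf X)=1\}+\frac1N\sum_{S\in\mathcal C}\mathbb P_S\{f(\mathbf X)=0\}, \] and $R^*=R^*(\mu)=R(f^*)$ is the risk of the optimal (likelihood ratio) test $f^*(\mathbf x)=\mathbf 1\{L(\mathbf x)>1\}$, where $L(\mathbf x)=\frac1N\sum_{S\in\mathcal C}\phi_S(\mathbf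 x)/\phi_0(\mathbf x)$. Then: (i) if $k\ge2$, then for all $\delta\in(0,1)$, $R^*\le\delta$ for every $\mu>0$ with \[ \mu\ge 2\sqrt{\frac1{k-1}\log\Bigl(\frac{me}{k}\Bigr)}+4\sqrt{\frac{\log(2/\delta)}{k(k-1)}}; \] (ii) $R^*\ge\frac12$ for every $\mu>0$ with \[ \mu\le\sqrt{\frac1k\log\Bigl(\frac m{2k}\Bigr)}. \] -/

import Mathlib

open MeasureTheory ProbabilityTheory

noncomputable section

namespace CliqueTesting

variable {ι : Type*} [Fintype ι]

/-- The mean of coordinate `i` when the contaminated set is `S`: it is `μ` on `S` and `0` off `S`. -/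
def meanAt (S : Finset ι) (μ : ℝ) (i : ι) : ℝ := by
  classical exact if i ∈ S then μ else 0

/-- The null law: independent standard normal coordinates. -/
def nullLaw (ι : Type*) [Fintype ι] : Measure (ι → ℝ) :=
  Measure.pi fun _ : ι => gaussianReal 0 1

/-- The law with contaminated set `S`: independent coordinates, normal with variance `1`,
with mean `μ` on `S` and mean `0` off `S`. -/
def contaminatedLaw (S : Finset ι) (μ : ℝ) : Measure (ι → ℝ) :=
  Measure.pi fun i => gaussianReal (meanAt S μ i) 1

/-- The Lebesgue density of the null law. -/
def nullDensity (x : ι → ℝ) : ℝ := ∏ i, gaussianPDFReal 0 1 (x i)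

/-- The Lebesgue density of the law with contaminated set `S`. -/
def contaminatedDensity (S : Finset ι) (μ : ℝ) (x : ι → ℝ) : ℝ :=
  ∏ i, gaussianPDFReal (meanAt S μ i) 1 (x i)

/-- The risk of a test `f` (`true` means that the null hypothesis is rejected) for the class `C`:
type I error plus the average over `S ∈ C` of the type II errors. -/
def risk (C : Finset (Finset ι)) (μ : ℝ) (f : (ι → ℝ) → Bool) : ℝ :=
  (nullLaw ι).real {x | f x = true} +
    1 / (C.card : ℝ) * ∑ S ∈ C, (contaminatedLaw S μ).real {x | f x = false}

/-- The likelihood ratio of the uniform mixture over `C` against the null law. -/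
def likelihoodRatio (C : Finset (Finset ι)) (μ : ℝ) (x : ι → ℝ) : ℝ :=
  (1 / (C.card : ℝ) * ∑ S ∈ C, contaminatedDensity S μ x) / nullDensity x

/-- The optimal (likelihood ratio) test: reject exactly when the likelihood ratio exceeds `1`. -/
def optimalTest (C : Finset (Finset ι)) (μ : ℝ) (x : ι → ℝ) : Bool := by
  classical exact decide (1 < likelihoodRatio C μ x)

/-- The Bayes risk `R*`: the risk of the optimal test. -/
def bayesRisk (C : Finset (Finset ι)) (μ : ℝ) : ℝ := risk C μ (optimalTest C μ)

/-- The edges of the complete graph on `m` vertices. -/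
abbrev Edge (m : ℕ) : Type := (⊤ : SimpleGraph (Fin m)).edgeSet

/-- The set of edges of the complete graph with both endpoints in the vertex set `V`. -/
def edgesWithin {m : ℕ} (V : Finset (Fin m)) : Finset (Edge m) :=
  Finset.univ.filter fun e => ∀ v ∈ (e : Sym2 (Fin m)), v ∈ V

/-- The class of (the edge sets of) all cliques on `k` vertices in the complete graph on `m`
vertices. -/
def cliqueClass (m k : ℕ) : Finset (Finset (Edge m)) :=
  ((⊤ : SimpleGraph (Fin m)).cliqueFinset k).image edgesWithin

end CliqueTesting

end

/-!
The likelihood ratio test has risk `R* = ∫ min(1, L)` under the null law, which gives both bounds.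

For the upper bound, `∫ min(1, L)` is at most the risk of any test, in particular of the one that
rejects when the sum over some clique is large. Gaussian tails and a union bound over the
`m.choose k ≤ (m e / k) ^ k` cliques control its risk.

For the lower bound, `min(1, L) ≥ L - L² / 4`, so it is enough that `E L² ≤ 2`. Now `E L²` is the
mean of `exp(μ² |S ∩ T|)` over pairs of cliques, and `|S ∩ T| = Z.choose 2` with `Z` the number of
common vertices, a hypergeometric variable. Its binomial moments `E (Z.choose j)` are at most
`k.choose j * (k / m) ^ j`, and expanding `exp(μ² Z.choose 2)` in them bounds `E L² - 1` by a
geometric series of ratio `3 / 5` starting at `j = 2`, whose sum is `9 / 10`.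
-/

open scoped NNReal ENNReal

namespace CliqueTesting

section GaussianShift

lemma pi_withDensity {ι : Type*} [Fintype ι] {Ω : ι → Type*} [∀ i, MeasurableSpace (Ω i)]
    (ν : ∀ i, Measure (Ω i)) [∀ i, IsProbabilityMeasure (ν i)] {f : ∀ i, Ω i → ℝ≥0∞}
    [∀ i, SigmaFinite ((ν i).withDensity (f i))] (hf : ∀ i, Measurable (f i)) :
    Measure.pi (fun i => (ν i).withDensity (f i)) =
      (Measure.pi ν).withDensity fun x => ∏ i, f i (x i) := by
  refine Measure.pi_eq fun s hs => ?_
  have hind : ∀ i, Measurable ((s i).indicator (f i)) := fun i => (hf i).indicator (hs i)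
  have hprod : (Set.univ.pi s).indicator (fun x => ∏ i, f i (x i)) =
      fun x => ∏ i, (s i).indicator (f i) (x i) := by
    ext x
    by_cases hx : ∀ i, x i ∈ s i
    · simp [Set.indicator_of_mem, hx]
    · obtain ⟨i, hi⟩ := not_forall.1 hx
      rw [Set.indicator_of_notMem (by simpa using ⟨i, hi⟩),
        Finset.prod_eq_zero (Finset.mem_univ i) (Set.indicator_of_notMem hi _)]
  rw [withDensity_apply _ (.univ_pi hs), ← lintegral_indicator (.univ_pi hs), hprod,
    lintegral_prod_eq_prod_lintegral_of_indepFun _ (fun i (x : ∀ i, Ω i) => _)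
      (iIndepFun_pi fun i => (hind i).aemeasurable)
      fun i => (hind i).comp (measurable_pi_apply i)]
  refine Finset.prod_congr rfl fun i _ => ?_
  rw [(measurePreserving_eval ν i).lintegral_comp (hind i), lintegral_indicator (hs i),
    withDensity_apply _ (hs i)]

lemma gaussianPDFReal_eq_mul_exp (a x : ℝ) (v : ℝ≥0) :
    gaussianPDFReal a v x = gaussianPDFReal 0 v x * Real.exp ((a * x - a ^ 2 / 2) / v) := by
  simp only [gaussianPDFReal, mul_assoc, ← Real.exp_add]
  congr 2
  ring

lemma gaussianReal_eq_withDensity_exp (a : ℝ) {v : ℝ≥0} (hv : v ≠ 0) :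
    gaussianReal a v = (gaussianReal 0 v).withDensity
      fun x => ENNReal.ofReal (Real.exp ((a * x - a ^ 2 / 2) / v)) := by
  rw [gaussianReal_of_var_ne_zero _ hv, gaussianReal_of_var_ne_zero _ hv,
    ← withDensity_mul _ (measurable_gaussianPDF _ _) (by fun_prop)]
  congr 1 with x
  simp only [gaussianPDF, Pi.mul_apply]
  rw [gaussianPDFReal_eq_mul_exp, ENNReal.ofReal_mul (gaussianPDFReal_nonneg _ _ _)]

lemma hasSubgaussianMGF_sub_gaussianReal (a : ℝ) (v : ℝ≥0) :
    HasSubgaussianMGF (fun x => x - a) v (gaussianReal a v) := by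
  have hlaw : (gaussianReal a v).map (fun x => x - a) = gaussianReal 0 v := by
    simp [gaussianReal_map_sub_const]
  refine .of_map (X := id) (by fun_prop) ?_
  rw [hlaw]
  exact ⟨fun t => integrable_exp_mul_gaussianReal t, fun t => by simp [mgf_id_gaussianReal]⟩

variable {ι : Type*} [Fintype ι]

/-- The density with respect to the standard Gaussian measure on `ι → ℝ` of its translate by `θ`. -/
noncomputable def gaussianShiftDensity (θ x : ι → ℝ) : ℝ := Real.exp (θ ⬝ᵥ x - θ ⬝ᵥ θ / 2)

lemma gaussianShiftDensity_eq_prod (θ x : ι → ℝ) :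
    gaussianShiftDensity θ x = ∏ i, Real.exp (θ i * x i - θ i ^ 2 / 2) := by
  simp only [gaussianShiftDensity, dotProduct, ← Real.exp_sum, Finset.sum_sub_distrib,
    Finset.sum_div, sq]

lemma gaussianShiftDensity_nonneg (θ x : ι → ℝ) : 0 ≤ gaussianShiftDensity θ x :=
  (Real.exp_pos _).le

lemma measurable_gaussianShiftDensity (θ : ι → ℝ) : Measurable (gaussianShiftDensity θ) := by
  unfold gaussianShiftDensity dotProduct
  fun_prop

lemma pi_gaussianReal_eq_withDensity (θ : ι → ℝ) :
    Measure.pi (fun i => gaussianReal (θ i) 1) =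
      (nullLaw ι).withDensity fun x => ENNReal.ofReal (gaussianShiftDensity θ x) := by
  have hcoord (i : ι) := gaussianReal_eq_withDensity_exp (θ i) one_ne_zero
  have (i : ι) : SigmaFinite ((gaussianReal 0 1).withDensity
      fun x => ENNReal.ofReal (Real.exp ((θ i * x - θ i ^ 2 / 2) / (1 : ℝ≥0)))) := by
    rw [← hcoord]
    infer_instance
  simp only [hcoord, gaussianShiftDensity_eq_prod]
  rw [pi_withDensity _ fun i => by fun_prop]
  simp [nullLaw, ENNReal.ofReal_prod_of_nonneg, Real.exp_nonneg]

instance : IsProbabilityMeasure (nullLaw ι) :=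
  inferInstanceAs (IsProbabilityMeasure (Measure.pi _))

instance (S : Finset ι) (μ : ℝ) : IsProbabilityMeasure (contaminatedLaw S μ) :=
  inferInstanceAs (IsProbabilityMeasure (Measure.pi _))

lemma lintegral_gaussianShiftDensity (θ : ι → ℝ) :
    ∫⁻ x, ENNReal.ofReal (gaussianShiftDensity θ x) ∂nullLaw ι = 1 := by
  rw [← setLIntegral_univ, ← withDensity_apply _ .univ, ← pi_gaussianReal_eq_withDensity,
    measure_univ]

lemma integrable_gaussianShiftDensity (θ : ι → ℝ) :
    Integrable (gaussianShiftDensity θ) (nullLaw ι) :=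
  (lintegral_ofReal_ne_top_iff_integrable
    (measurable_gaussianShiftDensity θ).aestronglyMeasurable
    (ae_of_all _ (gaussianShiftDensity_nonneg θ))).1 (by simp [lintegral_gaussianShiftDensity])

lemma integral_gaussianShiftDensity (θ : ι → ℝ) :
    ∫ x, gaussianShiftDensity θ x ∂nullLaw ι = 1 := by
  rw [integral_eq_lintegral_of_nonneg_ae (ae_of_all _ (gaussianShiftDensity_nonneg θ))
    (measurable_gaussianShiftDensity θ).aestronglyMeasurable, lintegral_gaussianShiftDensity,
    ENNReal.toReal_one]

lemma gaussianShiftDensity_mul (θ η x : ι → ℝ) :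
    gaussianShiftDensity θ x * gaussianShiftDensity η x =
      Real.exp (θ ⬝ᵥ η) * gaussianShiftDensity (θ + η) x := by
  simp only [gaussianShiftDensity, ← Real.exp_add, add_dotProduct, dotProduct_add,
    dotProduct_comm η θ]
  congr 1
  ring

lemma integrable_gaussianShiftDensity_mul (θ η : ι → ℝ) :
    Integrable (fun x => gaussianShiftDensity θ x * gaussianShiftDensity η x) (nullLaw ι) := by
  simp only [gaussianShiftDensity_mul]
  exact (integrable_gaussianShiftDensity _).const_mul _

lemma integral_gaussianShiftDensity_mul (θ η : ι → ℝ) :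
    ∫ x, gaussianShiftDensity θ x * gaussianShiftDensity η x ∂nullLaw ι =
      Real.exp (θ ⬝ᵥ η) := by
  simp only [gaussianShiftDensity_mul, integral_const_mul, integral_gaussianShiftDensity, mul_one]

lemma pi_gaussianReal_real_eq_setIntegral (θ : ι → ℝ) {A : Set (ι → ℝ)} (hA : MeasurableSet A) :
    (Measure.pi fun i => gaussianReal (θ i) 1).real A =
      ∫ x in A, gaussianShiftDensity θ x ∂nullLaw ι := by
  rw [pi_gaussianReal_eq_withDensity, measureReal_def, withDensity_apply _ hA,
    integral_eq_lintegral_of_nonneg_ae (ae_of_all _ (gaussianShiftDensity_nonneg θ))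
      (measurable_gaussianShiftDensity θ).aestronglyMeasurable]

lemma pi_gaussianReal_real_le_sum_mul_le (θ a : ι → ℝ) (S : Finset ι) {t : ℝ} (ht : 0 ≤ t) :
    (Measure.pi fun i => gaussianReal (θ i) 1).real {x | t ≤ ∑ i ∈ S, a i * (x i - θ i)} ≤
      Real.exp (-t ^ 2 / (2 * ∑ i ∈ S, a i ^ 2)) := by
  have hindep : iIndepFun (fun i (x : ι → ℝ) => a i * (x i - θ i))
      (Measure.pi fun i => gaussianReal (θ i) 1) :=
    iIndepFun_pi (X := fun i x => a i * (x - θ i)) fun i => by fun_prop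
  have hsub (i : ι) : HasSubgaussianMGF (fun x : ι → ℝ => a i * (x i - θ i))
      (‖a i‖₊ ^ 2) (Measure.pi fun i => gaussianReal (θ i) 1) := by
    have hcenter : HasSubgaussianMGF (fun x : ι → ℝ => x i - θ i) 1
        (Measure.pi fun i => gaussianReal (θ i) 1) :=
      .of_map (X := fun x : ℝ => x - θ i) (measurable_pi_apply i).aemeasurable <|
        (measurePreserving_eval (fun i => gaussianReal (θ i) 1) i).map_eq ▸
          hasSubgaussianMGF_sub_gaussianReal _ _
    convert hcenter.const_mul (a i)
    ext
    change ‖a i‖ ^ 2 = a i ^ 2 * 1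
    simp
  simpa using HasSubgaussianMGF.measure_sum_ge_le_of_iIndepFun hindep (fun i _ => hsub i) ht

end GaussianShift

section LikelihoodRatioTest

variable {ι : Type*} [Fintype ι] (C : Finset (Finset ι)) (μ : ℝ)

lemma meanAt_dotProduct_meanAt [DecidableEq ι] (S T : Finset ι) :
    meanAt S μ ⬝ᵥ meanAt T μ = μ ^ 2 * (S ∩ T).card := by
  simp only [dotProduct, meanAt, ite_zero_mul_ite_zero, ← Finset.mem_inter, Finset.sum_ite_mem,
    Finset.univ_inter, Finset.sum_const, nsmul_eq_mul, ← sq, mul_comm]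

lemma contaminatedLaw_real_eq_setIntegral (S : Finset ι) {A : Set (ι → ℝ)}
    (hA : MeasurableSet A) :
    (contaminatedLaw S μ).real A =
      ∫ x in A, gaussianShiftDensity (meanAt S μ) x ∂nullLaw ι :=
  pi_gaussianReal_real_eq_setIntegral _ hA

lemma contaminatedDensity_eq_mul (S : Finset ι) (x : ι → ℝ) :
    contaminatedDensity S μ x = nullDensity x * gaussianShiftDensity (meanAt S μ) x := by
  simp only [contaminatedDensity, nullDensity, gaussianShiftDensity_eq_prod,
    ← Finset.prod_mul_distrib]
  refine Finset.prod_congr rfl fun i _ => ?_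
  rw [gaussianPDFReal_eq_mul_exp, NNReal.coe_one, div_one]

lemma likelihoodRatio_eq_average :
    likelihoodRatio C μ =
      fun x => 1 / (C.card : ℝ) * ∑ S ∈ C, gaussianShiftDensity (meanAt S μ) x := by
  ext x
  have hpos : 0 < nullDensity x := Finset.prod_pos fun _ _ => gaussianPDFReal_pos _ _ _ one_ne_zero
  simp only [likelihoodRatio, contaminatedDensity_eq_mul, ← Finset.mul_sum]
  field_simp

lemma measurable_likelihoodRatio : Measurable (likelihoodRatio C μ) := by
  rw [likelihoodRatio_eq_average]
  exact (Finset.measurable_sum _ fun S _ => measurable_gaussianShiftDensity _).const_mul _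

lemma integrable_likelihoodRatio : Integrable (likelihoodRatio C μ) (nullLaw ι) := by
  rw [likelihoodRatio_eq_average]
  exact (integrable_finsetSum _ fun S _ => integrable_gaussianShiftDensity _).const_mul _

lemma measurable_optimalTest : Measurable (optimalTest C μ) := by
  refine measurable_to_bool ?_
  have hreject : optimalTest C μ ⁻¹' {true} = {x | 1 < likelihoodRatio C μ x} := by
    ext x
    simp [optimalTest]
  rw [hreject]
  exact measurableSet_lt measurable_const (measurable_likelihoodRatio C μ)

lemma average_contaminatedLaw_real {A : Set (ι → ℝ)} (hA : MeasurableSet A) :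
    1 / (C.card : ℝ) * ∑ S ∈ C, (contaminatedLaw S μ).real A =
      ∫ x in A, likelihoodRatio C μ x ∂nullLaw ι := by
  rw [likelihoodRatio_eq_average, integral_const_mul,
    integral_finsetSum _ fun S _ => (integrable_gaussianShiftDensity _).restrict]
  simp only [contaminatedLaw_real_eq_setIntegral μ _ hA]

lemma integrable_ite_likelihoodRatio {f : (ι → ℝ) → Bool} (hf : Measurable f) :
    Integrable (fun x => if f x = true then 1 else likelihoodRatio C μ x) (nullLaw ι) :=
  .piecewise (s := {x | f x = true}) (hf (measurableSet_singleton true))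
    (integrable_const 1).integrableOn (integrable_likelihoodRatio C μ).integrableOn

lemma risk_eq_integral {f : (ι → ℝ) → Bool} (hf : Measurable f) :
    risk C μ f = ∫ x, (if f x = true then 1 else likelihoodRatio C μ x) ∂nullLaw ι := by
  have hreject : MeasurableSet {x | f x = true} := hf (measurableSet_singleton true)
  have haccept : {x | f x = false} = {x | f x = true}ᶜ := by ext x; simp
  rw [risk, haccept, average_contaminatedLaw_real C μ hreject.compl,
    ← integral_add_compl hreject (integrable_ite_likelihoodRatio C μ hf)]
  congr 1
  · trans ∫ _ in {x | f x = true}, 1 ∂nullLaw ι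
    · rw [setIntegral_const, smul_eq_mul, mul_one]
    · exact setIntegral_congr_fun hreject fun x hx => (if_pos hx).symm
  · exact setIntegral_congr_fun hreject.compl fun x hx => (if_neg hx).symm

lemma bayesRisk_eq_integral_min :
    bayesRisk C μ = ∫ x, min 1 (likelihoodRatio C μ x) ∂nullLaw ι := by
  rw [bayesRisk, risk_eq_integral C μ (measurable_optimalTest C μ)]
  congr 1 with x
  rcases lt_or_ge 1 (likelihoodRatio C μ x) with h | h
  · simp [optimalTest, h, h.le]
  · simp [optimalTest, h, h.not_gt]

lemma bayesRisk_le_risk {f : (ι → ℝ) → Bool} (hf : Measurable f) : bayesRisk C μ ≤ risk C μ f := by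
  rw [bayesRisk_eq_integral_min, risk_eq_integral C μ hf]
  refine integral_mono ((integrable_const 1).inf (integrable_likelihoodRatio C μ))
    (integrable_ite_likelihoodRatio C μ hf) fun x => ?_
  dsimp only
  split_ifs
  exacts [min_le_left _ _, min_le_right _ _]

end LikelihoodRatioTest

section SecondMoment

variable {ι : Type*} [Fintype ι] {C : Finset (Finset ι)}

lemma integral_likelihoodRatio (hC : C.Nonempty) (μ : ℝ) :
    ∫ x, likelihoodRatio C μ x ∂nullLaw ι = 1 := by
  rw [← setIntegral_univ, ← average_contaminatedLaw_real C μ .univ]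
  simp [hC.card_ne_zero]

lemma likelihoodRatio_sq_eq (μ : ℝ) (x : ι → ℝ) :
    likelihoodRatio C μ x ^ 2 = 1 / (C.card : ℝ) ^ 2 * ∑ S ∈ C, ∑ T ∈ C,
      gaussianShiftDensity (meanAt S μ) x * gaussianShiftDensity (meanAt T μ) x := by
  simp only [likelihoodRatio_eq_average, mul_pow, one_div, inv_pow, sq (∑ _ ∈ C, _),
    Finset.sum_mul_sum]

lemma integrable_likelihoodRatio_sq (μ : ℝ) :
    Integrable (fun x => likelihoodRatio C μ x ^ 2) (nullLaw ι) := by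
  simp only [likelihoodRatio_sq_eq]
  exact (integrable_finsetSum _ fun S _ => integrable_finsetSum _ fun T _ =>
    integrable_gaussianShiftDensity_mul _ _).const_mul _

lemma integral_likelihoodRatio_sq [DecidableEq ι] (μ : ℝ) :
    ∫ x, likelihoodRatio C μ x ^ 2 ∂nullLaw ι =
      1 / (C.card : ℝ) ^ 2 * ∑ S ∈ C, ∑ T ∈ C, Real.exp (μ ^ 2 * (S ∩ T).card) := by
  simp only [likelihoodRatio_sq_eq, integral_const_mul]
  rw [integral_finsetSum _ fun _ _ => integrable_finsetSum _ fun _ _ =>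
    integrable_gaussianShiftDensity_mul _ _]
  simp only [integral_finsetSum _ fun _ _ => integrable_gaussianShiftDensity_mul _ _,
    integral_gaussianShiftDensity_mul, meanAt_dotProduct_meanAt]

lemma one_sub_integral_likelihoodRatio_sq_div_four_le_bayesRisk (hC : C.Nonempty) (μ : ℝ) :
    1 - (∫ x, likelihoodRatio C μ x ^ 2 ∂nullLaw ι) / 4 ≤ bayesRisk C μ := by
  have hL := integrable_likelihoodRatio C μ
  have hsq := (integrable_likelihoodRatio_sq (C := C) μ).div_const 4
  have hpointwise (x : ι → ℝ) :
      likelihoodRatio C μ x - likelihoodRatio C μ x ^ 2 / 4 ≤ min 1 (likelihoodRatio C μ x) :=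
    le_min (by linarith [sq_nonneg (likelihoodRatio C μ x / 2 - 1)])
      (by linarith [sq_nonneg (likelihoodRatio C μ x)])
  calc 1 - (∫ x, likelihoodRatio C μ x ^ 2 ∂nullLaw ι) / 4
      = ∫ x, likelihoodRatio C μ x - likelihoodRatio C μ x ^ 2 / 4 ∂nullLaw ι := by
        rw [integral_sub hL hsq, integral_div, integral_likelihoodRatio hC]
    _ ≤ ∫ x, min 1 (likelihoodRatio C μ x) ∂nullLaw ι :=
        integral_mono (hL.sub hsq) ((integrable_const 1).inf hL) hpointwise
    _ = bayesRisk C μ := (bayesRisk_eq_integral_min C μ).symm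

lemma half_le_bayesRisk_of_sum_exp_card_inter_le [DecidableEq ι] (hC : C.Nonempty) {μ : ℝ}
    (h : ∀ S ∈ C, ∑ T ∈ C, Real.exp (μ ^ 2 * (S ∩ T).card) ≤ 2 * C.card) :
    1 / 2 ≤ bayesRisk C μ := by
  have hcard : (0 : ℝ) < C.card := by exact_mod_cast hC.card_pos
  have hsecond : ∫ x, likelihoodRatio C μ x ^ 2 ∂nullLaw ι ≤ 2 := by
    rw [integral_likelihoodRatio_sq, one_div, inv_mul_le_iff₀ (by positivity)]
    refine (Finset.sum_le_card_nsmul _ _ _ h).trans_eq ?_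
    rw [nsmul_eq_mul]
    ring
  linarith [one_sub_integral_likelihoodRatio_sq_div_four_le_bayesRisk hC μ]

end SecondMoment

section ScanTest

variable {ι : Type*}

/-- The scan test at level `t`: it rejects the null hypothesis when the sum of the coordinates over
some set of the class is at least `t`. -/
noncomputable def scanTest (C : Finset (Finset ι)) (t : ℝ) (x : ι → ℝ) : Bool := by
  classical exact decide (∃ S ∈ C, t ≤ ∑ i ∈ S, x i)

lemma setOf_scanTest_eq_true (C : Finset (Finset ι)) (t : ℝ) :
    {x | scanTest C t x = true} = ⋃ S ∈ C, {x | t ≤ ∑ i ∈ S, x i} := by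
  ext x
  simp [scanTest]

lemma measurable_scanTest (C : Finset (Finset ι)) (t : ℝ) : Measurable (scanTest C t) := by
  refine measurable_to_bool ?_
  change MeasurableSet {x | scanTest C t x = true}
  rw [setOf_scanTest_eq_true]
  exact C.measurableSet_biUnion fun S _ => measurableSet_le measurable_const (by fun_prop)

lemma sum_meanAt (S : Finset ι) (μ : ℝ) : ∑ i ∈ S, meanAt S μ i = μ * S.card := by
  simp [meanAt, mul_comm]

variable [Fintype ι]

lemma nullLaw_real_le_sum_le (S : Finset ι) {t : ℝ} (ht : 0 ≤ t) :
    (nullLaw ι).real {x | t ≤ ∑ i ∈ S, x i} ≤ Real.exp (-t ^ 2 / (2 * S.card)) := by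
  simpa [nullLaw] using pi_gaussianReal_real_le_sum_mul_le 0 1 S ht

lemma contaminatedLaw_real_sum_le_le {S : Finset ι} {μ t : ℝ} (ht : t ≤ μ * S.card) :
    (contaminatedLaw S μ).real {x | ∑ i ∈ S, x i ≤ t} ≤
      Real.exp (-(μ * S.card - t) ^ 2 / (2 * S.card)) := by
  have hset : {x : ι → ℝ | ∑ i ∈ S, x i ≤ t} =
      {x | μ * S.card - t ≤ ∑ i ∈ S, -1 * (x i - meanAt S μ i)} := by
    ext x
    rw [Set.mem_ofPred_eq, Set.mem_ofPred_eq, ← Finset.mul_sum, Finset.sum_sub_distrib, sum_meanAt]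
    constructor <;> intro h <;> linarith
  rw [hset]
  simpa [contaminatedLaw] using
    pi_gaussianReal_real_le_sum_mul_le (meanAt S μ) (-1) S (sub_nonneg.2 ht)

lemma risk_scanTest_le {C : Finset (Finset ι)} (hC : C.Nonempty) {K : ℕ}
    (hcard : ∀ S ∈ C, S.card = K) {μ t : ℝ} (ht : 0 ≤ t) (htμ : t ≤ μ * K) :
    risk C μ (scanTest C t) ≤ C.card * Real.exp (-t ^ 2 / (2 * K)) +
      Real.exp (-(μ * K - t) ^ 2 / (2 * K)) := by
  refine add_le_add ?_ ?_
  · rw [setOf_scanTest_eq_true, ← nsmul_eq_mul]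
    refine (measureReal_biUnion_finset_le _ _).trans (Finset.sum_le_card_nsmul _ _ _ ?_)
    intro S hS
    simpa only [hcard S hS] using nullLaw_real_le_sum_le S ht
  · rw [one_div, inv_mul_le_iff₀ (by exact_mod_cast hC.card_pos), ← nsmul_eq_mul]
    refine Finset.sum_le_card_nsmul _ _ _ fun S hS => ?_
    have hmiss : {x | scanTest C t x = false} ⊆ {x | ∑ i ∈ S, x i ≤ t} := fun x hx => by
      have hlt : ∀ T ∈ C, ∑ i ∈ T, x i < t := by simpa [scanTest] using hx
      exact (hlt S hS).le
    rw [← hcard S hS] at htμ ⊢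
    exact (measureReal_mono hmiss).trans (contaminatedLaw_real_sum_le_le htμ)

lemma add_le_sq_mul_div_two_of_sqrt_add_sqrt_le {x y K s : ℝ} (hx : 0 ≤ x) (hy : 0 ≤ y)
    (hK : 0 < K) (h : √(2 * x / K) + √(2 * y / K) ≤ s) : x + y ≤ s ^ 2 * K / 2 := by
  have hsq : 2 * x / K + 2 * y / K ≤ s ^ 2 := calc
    2 * x / K + 2 * y / K = √(2 * x / K) ^ 2 + √(2 * y / K) ^ 2 := by
      rw [Real.sq_sqrt (by positivity), Real.sq_sqrt (by positivity)]
    _ ≤ (√(2 * x / K) + √(2 * y / K)) ^ 2 :=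
      pow_add_pow_le (Real.sqrt_nonneg _) (Real.sqrt_nonneg _) two_ne_zero
    _ ≤ s ^ 2 := by gcongr
  calc x + y = (2 * x / K + 2 * y / K) * K / 2 := by field_simp
    _ ≤ s ^ 2 * K / 2 := by gcongr

theorem bayesRisk_le_of_card_eq {C : Finset (Finset ι)} (hC : C.Nonempty) {K : ℕ} (hK : 0 < K)
    (hcard : ∀ S ∈ C, S.card = K) {δ μ : ℝ} (hδ : 0 < δ) (hδ2 : δ ≤ 2)
    (hμ : √(2 * Real.log C.card / K) + 2 * √(2 * Real.log (2 / δ) / K) ≤ μ) :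
    bayesRisk C μ ≤ δ := by
  have hK' : (0 : ℝ) < K := by exact_mod_cast hK
  have hC' : (1 : ℝ) ≤ C.card := by exact_mod_cast hC.card_pos
  have hlogN : 0 ≤ Real.log C.card := Real.log_nonneg hC'
  have hlogδ : 0 ≤ Real.log (2 / δ) := Real.log_nonneg ((one_le_div₀ hδ).2 hδ2)
  have hexpδ : Real.exp (-Real.log (2 / δ)) = δ / 2 := by
    rw [← Real.log_inv, inv_div, Real.exp_log (by positivity)]
  set b := √(2 * Real.log (2 / δ) / K) with hb
  have hb0 : 0 ≤ b := Real.sqrt_nonneg _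
  have hbμ : b ≤ μ := by linarith [Real.sqrt_nonneg (2 * Real.log C.card / K)]
  -- the largest threshold `(μ - b) * K` at which the type II error is still at most `δ / 2`
  have hscan := risk_scanTest_le hC hcard (μ := μ) (t := (μ - b) * K)
    (mul_nonneg (sub_nonneg.2 hbμ) hK'.le) (by gcongr; linarith)
  have htypeI : C.card * Real.exp (-((μ - b) * K) ^ 2 / (2 * K)) ≤ δ / 2 := by
    have hexponent := add_le_sq_mul_div_two_of_sqrt_add_sqrt_le hlogN hlogδ hK' (s := μ - b)
      (by linarith)
    calc C.card * Real.exp (-((μ - b) * K) ^ 2 / (2 * K))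
        = C.card * Real.exp (-((μ - b) ^ 2 * K / 2)) := by congr 2; field_simp
      _ ≤ C.card * Real.exp (-Real.log C.card + -Real.log (2 / δ)) := by gcongr; linarith
      _ = δ / 2 := by
        rw [Real.exp_add, hexpδ, Real.exp_neg, Real.exp_log (by linarith)]
        field_simp
  have htypeII : Real.exp (-(μ * K - (μ - b) * K) ^ 2 / (2 * K)) = δ / 2 := by
    rw [← hexpδ, ← sub_mul, sub_sub_cancel, mul_pow, hb, Real.sq_sqrt (by positivity)]
    congr 1
    field_simp
  linarith [bayesRisk_le_risk C μ (measurable_scanTest C ((μ - b) * K))]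

end ScanTest

section Cliques

variable {m k : ℕ}

lemma card_edgesWithin (V : Finset (Fin m)) : (edgesWithin V).card = V.card.choose 2 := by
  rw [← Sym2.card_image_offDiag, ← Finset.card_map (Function.Embedding.subtype _)]
  congr 1
  ext e
  induction e using Sym2.ind with
  | _ a b =>
    simp only [edgesWithin, Finset.mem_map, Finset.mem_filter, Finset.mem_univ, true_and,
      Function.Embedding.coe_subtype, Subtype.exists, Finset.mem_image, Finset.mem_offDiag,
      Prod.exists, Function.uncurry_apply_pair]
    constructor
    · rintro ⟨e, he, h, rfl⟩
      exact ⟨a, b, ⟨h a (by simp), h b (by simp), by simpa using he⟩, rfl⟩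
    · rintro ⟨c, d, ⟨hc, hd, hcd⟩, h⟩
      refine ⟨s(a, b), ?_, ?_, rfl⟩ <;> rw [← h]
      · simpa using hcd
      · simp [hc, hd]

lemma edgesWithin_inter [DecidableEq (Edge m)] (V W : Finset (Fin m)) :
    edgesWithin V ∩ edgesWithin W = edgesWithin (V ∩ W) := by
  ext e
  simp only [edgesWithin, Finset.mem_inter, Finset.mem_filter, Finset.mem_univ, true_and,
    imp_and, forall_and]

lemma subset_of_edgesWithin_subset {V W : Finset (Fin m)} (hV : 2 ≤ V.card)
    (h : edgesWithin V ⊆ edgesWithin W) : V ⊆ W := by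
  intro v hv
  obtain ⟨w, hw, hne⟩ := Finset.exists_mem_ne hV v
  have hvw : (⟨s(v, w), by simpa using hne.symm⟩ : Edge m) ∈ edgesWithin V := by
    simp [edgesWithin, hv, hw]
  exact (Finset.mem_filter.1 (h hvw)).2 v (by simp)

lemma cliqueClass_eq_image_powersetCard (m k : ℕ) :
    cliqueClass m k = (Finset.univ.powersetCard k).image edgesWithin := by
  unfold cliqueClass
  congr 1
  ext V
  simp [SimpleGraph.isNClique_iff, SimpleGraph.isClique_iff, Set.Pairwise]

lemma injOn_edgesWithin_powersetCard (hk : 2 ≤ k) :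
    Set.InjOn (edgesWithin (m := m)) (Finset.univ.powersetCard k : Finset (Finset (Fin m))) := by
  intro V hV W hW h
  have hV : 2 ≤ V.card := by rwa [(Finset.mem_powersetCard.1 hV).2]
  have hW : 2 ≤ W.card := by rwa [(Finset.mem_powersetCard.1 hW).2]
  exact (subset_of_edgesWithin_subset hV h.le).antisymm (subset_of_edgesWithin_subset hW h.ge)

lemma card_cliqueClass (hk : 2 ≤ k) : (cliqueClass m k).card = m.choose k := by
  rw [cliqueClass_eq_image_powersetCard,
    Finset.card_image_of_injOn (injOn_edgesWithin_powersetCard hk), Finset.card_powersetCard,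
    Finset.card_univ, Fintype.card_fin]

lemma card_of_mem_cliqueClass {S : Finset (Edge m)} (hS : S ∈ cliqueClass m k) :
    S.card = k.choose 2 := by
  rw [cliqueClass_eq_image_powersetCard] at hS
  obtain ⟨V, hV, rfl⟩ := Finset.mem_image.1 hS
  rw [card_edgesWithin, (Finset.mem_powersetCard.1 hV).2]

lemma cliqueClass_nonempty (h : k ≤ m) : (cliqueClass m k).Nonempty := by
  rw [cliqueClass_eq_image_powersetCard]
  exact (Finset.powersetCard_nonempty.2 (by simpa using h)).image _

end Cliques

section Counting

lemma sum_choose_card_inter {α : Type*} [DecidableEq α] {U V : Finset α} (hVU : V ⊆ U) {j k : ℕ}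
    (hjk : j ≤ k) :
    ∑ W ∈ U.powersetCard k, (V ∩ W).card.choose j =
      V.card.choose j * (U.card - j).choose (k - j) := by
  have hindicator (W : Finset α) :
      (V ∩ W).card.choose j = ∑ A ∈ V.powersetCard j, if A ⊆ W then 1 else 0 := by
    rw [← Finset.card_powersetCard, Finset.sum_boole, Nat.cast_id]
    congr 1
    ext A
    simp only [Finset.mem_powersetCard, Finset.mem_filter, Finset.subset_inter_iff]
    tauto
  have hsupersets : ∀ A ∈ V.powersetCard j,
      (∑ W ∈ U.powersetCard k, if A ⊆ W then 1 else 0) = (U.card - j).choose (k - j) := by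
    intro A hA
    obtain ⟨hAV, hA⟩ := Finset.mem_powersetCard.1 hA
    rw [Finset.sum_boole, Nat.cast_id,
      Finset.card_filter_powersetCard_subset A U k (hAV.trans hVU) (hA.trans_le hjk), hA]
  simp only [hindicator]
  rw [Finset.sum_comm, Finset.sum_congr rfl hsupersets, Finset.sum_const,
    Finset.card_powersetCard, smul_eq_mul]

lemma choose_mul_add_pow_le (a b j : ℕ) :
    b.choose a * (b + j) ^ j ≤ (a + j) ^ j * (b + j).choose (a + j) := by
  induction j generalizing a b with
  | zero => simp
  | succ j ih =>
    have hstep : b.choose a * (b + 1 + j) ≤ (a + 1 + j) * (b + 1).choose (a + 1) := by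
      have habsorb := Nat.add_one_mul_choose_eq b a
      have hpascal := Nat.choose_succ_succ b a
      nlinarith
    calc b.choose a * (b + (j + 1)) ^ (j + 1)
        = b.choose a * (b + 1 + j) * (b + 1 + j) ^ j := by ring
      _ ≤ (a + 1 + j) * (b + 1).choose (a + 1) * (b + 1 + j) ^ j := by gcongr
      _ = (a + 1 + j) * ((b + 1).choose (a + 1) * (b + 1 + j) ^ j) := by ring
      _ ≤ (a + 1 + j) * ((a + 1 + j) ^ j * (b + 1 + j).choose (a + 1 + j)) :=
        Nat.mul_le_mul_left _ (ih (a + 1) (b + 1))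
      _ = (a + (j + 1)) ^ (j + 1) * (b + (j + 1)).choose (a + (j + 1)) := by
        rw [add_right_comm a, add_right_comm b]
        ring_nf

lemma choose_sub_sub_le {m k j : ℕ} (hkm : k ≤ m) (hjk : j ≤ k) :
    ((m - j).choose (k - j) : ℝ) ≤ ((k : ℝ) / m) ^ j * m.choose k := by
  have h := choose_mul_add_pow_le (k - j) (m - j) j
  rw [Nat.sub_add_cancel hjk, Nat.sub_add_cancel (hjk.trans hkm)] at h
  rcases m.eq_zero_or_pos with rfl | hm
  · obtain rfl : k = 0 := by omega
    obtain rfl : j = 0 := by omega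
    simp
  · rw [div_pow, div_mul_eq_mul_div, le_div_iff₀ (by positivity)]
    exact_mod_cast h

lemma choose_le_exp_mul_div_pow (n j : ℕ) : (n.choose j : ℝ) ≤ (n * Real.exp 1 / j) ^ j := by
  have hexp := Real.pow_div_factorial_le_exp (j : ℝ) j.cast_nonneg j
  have hj : (0 : ℝ) < (j : ℝ) ^ j := by exact_mod_cast Nat.pow_self_pos
  calc (n.choose j : ℝ) ≤ n ^ j / j.factorial := Nat.choose_le_pow_div j n
    _ = n ^ j * (j ^ j / j.factorial) / j ^ j := by field_simp
    _ ≤ n ^ j * Real.exp j / j ^ j := by gcongr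
    _ = (n * Real.exp 1 / j) ^ j := by rw [div_pow, mul_pow, ← Real.exp_nat_mul, mul_one]

lemma le_one_add_sum_choose_mul {g : ℕ → ℝ} (hg : ∀ j, 0 ≤ g j) (hg0 : g 0 ≤ 1) (hg1 : g 1 ≤ 1)
    {k z : ℕ} (hz : z ≤ k) : g z ≤ 1 + ∑ j ∈ Finset.Ico 2 (k + 1), (z.choose j : ℝ) * g j := by
  have hnonneg : ∀ j ∈ Finset.Ico 2 (k + 1), 0 ≤ (z.choose j : ℝ) * g j :=
    fun j _ => mul_nonneg (Nat.cast_nonneg _) (hg j)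
  have hsum := Finset.sum_nonneg hnonneg
  rcases lt_or_ge z 2 with hlt | hge
  · interval_cases z <;> linarith
  · have hterm := Finset.single_le_sum hnonneg (Finset.mem_Ico.2 ⟨hge, Nat.lt_succ_of_le hz⟩)
    rw [Nat.choose_self, Nat.cast_one, one_mul] at hterm
    linarith

lemma sum_card_inter_le {α : Type*} [DecidableEq α] {U V : Finset α} (hVU : V ⊆ U) {k : ℕ}
    (hV : V.card = k) {g : ℕ → ℝ} (hg : ∀ j, 0 ≤ g j) (hg0 : g 0 ≤ 1) (hg1 : g 1 ≤ 1) :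
    ∑ W ∈ U.powersetCard k, g (V ∩ W).card ≤
      (1 + ∑ j ∈ Finset.Ico 2 (k + 1), (k.choose j : ℝ) * ((k : ℝ) / U.card) ^ j * g j) *
        U.card.choose k := by
  have hkU : k ≤ U.card := hV ▸ Finset.card_le_card hVU
  calc ∑ W ∈ U.powersetCard k, g (V ∩ W).card
      ≤ ∑ W ∈ U.powersetCard k,
          (1 + ∑ j ∈ Finset.Ico 2 (k + 1), ((V ∩ W).card.choose j : ℝ) * g j) :=
        Finset.sum_le_sum fun W _ => le_one_add_sum_choose_mul hg hg0 hg1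
          (hV ▸ Finset.card_le_card Finset.inter_subset_left)
    _ = U.card.choose k +
          ∑ j ∈ Finset.Ico 2 (k + 1), (∑ W ∈ U.powersetCard k, (V ∩ W).card.choose j : ℕ) * g j
        := by
        rw [Finset.sum_add_distrib, Finset.sum_comm]
        simp [Finset.sum_mul]
    _ ≤ U.card.choose k + ∑ j ∈ Finset.Ico 2 (k + 1),
          (k.choose j * (((k : ℝ) / U.card) ^ j * U.card.choose k)) * g j := by
        gcongr with j hj
        · exact hg j
        · have hjk : j ≤ k := Nat.le_of_lt_succ (Finset.mem_Ico.1 hj).2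
          rw [sum_choose_card_inter hVU hjk, hV, Nat.cast_mul]
          gcongr
          exact choose_sub_sub_le hkU hjk
    _ = _ := by
        rw [add_mul, one_mul, Finset.sum_mul]
        congr 1
        exact Finset.sum_congr rfl fun j _ => by ring

end Counting

section Estimates

/-- Bernoulli's inequality for `√r = 1 + (√r - 1)` with exponent `(j - 1) / k ≤ 1` trades the
exponential growth for a base that is linear in `j`; `√r - 1 ≤ r / 4` is AM-GM. -/
lemma exp_mul_choose_two_le {k j : ℕ} (hj : 1 ≤ j) (hjk : j ≤ k) {r s : ℝ} (hr : 1 ≤ r)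
    (hs : s ≤ 1 / k * Real.log r) :
    Real.exp (s * j.choose 2) ≤ (1 + (j - 1) * r / (4 * k)) ^ j := by
  have hj' : (1 : ℝ) ≤ j := by exact_mod_cast hj
  have hjk' : (j : ℝ) ≤ k := by exact_mod_cast hjk
  have hk : (0 : ℝ) < k := by linarith
  have hsqrt : 0 < √r := Real.sqrt_pos.2 (by linarith)
  have hsqrt_sub : √r - 1 ≤ r / 4 := by
    nlinarith [sq_nonneg (√r - 2), Real.sq_sqrt (by linarith : 0 ≤ r)]
  have hp0 : 0 ≤ ((j : ℝ) - 1) / k := div_nonneg (by linarith) hk.le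
  have hp1 : ((j : ℝ) - 1) / k ≤ 1 := (div_le_one hk).2 (by linarith)
  have hbase : Real.exp ((j - 1) / (2 * k) * Real.log r) ≤ 1 + (j - 1) * r / (4 * k) := by
    calc Real.exp ((j - 1) / (2 * k) * Real.log r)
        = (1 + (√r - 1)) ^ (((j : ℝ) - 1) / k) := by
          rw [add_sub_cancel, Real.rpow_def_of_pos hsqrt, Real.log_sqrt (by linarith)]
          congr 1
          field_simp
      _ ≤ 1 + (j - 1) / k * (√r - 1) := rpow_one_add_le_one_add_mul_self (by linarith) hp0 hp1
      _ ≤ 1 + (j - 1) / k * (r / 4) := by gcongr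
      _ = 1 + (j - 1) * r / (4 * k) := by field_simp
  calc Real.exp (s * j.choose 2)
      ≤ Real.exp (1 / k * Real.log r * j.choose 2) := by gcongr
    _ = Real.exp ((j - 1) / (2 * k) * Real.log r) ^ j := by
        rw [← Real.exp_nat_mul, Nat.cast_choose_two]
        congr 1
        field_simp
    _ ≤ (1 + (j - 1) * r / (4 * k)) ^ j := by gcongr

lemma choose_mul_div_pow_mul_exp_le {m k j : ℕ} (hj : 2 ≤ j) (hjk : j ≤ k)
    (hkm : 10 * k ^ 2 ≤ 3 * m) {s : ℝ} (hs : s ≤ 1 / k * Real.log (m / (2 * k))) :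
    (k.choose j : ℝ) * ((k : ℝ) / m) ^ j * Real.exp (s * j.choose 2) ≤ (3 / 5) ^ j := by
  have hj' : (2 : ℝ) ≤ j := by exact_mod_cast hj
  have hk : (2 : ℝ) ≤ k := by exact_mod_cast hj.trans hjk
  have hkm' : (10 : ℝ) * k ^ 2 ≤ 3 * m := by exact_mod_cast hkm
  have hm : (0 : ℝ) < m := by nlinarith
  have he : Real.exp 1 < 2.7183 := Real.exp_one_lt_d9.trans (by norm_num)
  have hr : 1 ≤ (m : ℝ) / (2 * k) := by
    rw [le_div_iff₀ (by positivity)]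
    nlinarith
  have hbase : (k : ℝ) ^ 2 * Real.exp 1 / m + Real.exp 1 * (j - 1) / 8 ≤ 3 / 5 * j := by
    have hdiv : (k : ℝ) ^ 2 / m ≤ 3 / 10 := by
      rw [div_le_iff₀ hm]
      linarith
    rw [mul_div_right_comm]
    nlinarith [Real.exp_pos 1]
  calc (k.choose j : ℝ) * ((k : ℝ) / m) ^ j * Real.exp (s * j.choose 2)
      ≤ (k * Real.exp 1 / j) ^ j * ((k : ℝ) / m) ^ j *
          (1 + (j - 1) * (m / (2 * k)) / (4 * k)) ^ j := by
        gcongr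
        · exact choose_le_exp_mul_div_pow k j
        · exact exp_mul_choose_two_le (by omega) hjk hr hs
    _ = ((k ^ 2 * Real.exp 1 / m + Real.exp 1 * (j - 1) / 8) / j) ^ j := by
        rw [← mul_pow, ← mul_pow]
        congr 1
        field_simp
        ring
    _ ≤ (3 / 5) ^ j := by
        have hj1 : 0 ≤ (j : ℝ) - 1 := by linarith
        exact pow_le_pow_left₀ (by positivity) ((div_le_iff₀ (by positivity)).2 hbase) j

lemma sum_exp_mul_card_inter_choose_two_le {α : Type*} [DecidableEq α] {U V : Finset α}
    (hVU : V ⊆ U) (hU : 10 * V.card ^ 2 ≤ 3 * U.card) {s : ℝ}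
    (hs : s ≤ 1 / V.card * Real.log (U.card / (2 * V.card))) :
    ∑ W ∈ U.powersetCard V.card, Real.exp (s * (V ∩ W).card.choose 2) ≤
      2 * U.card.choose V.card := by
  set k := V.card
  have hgeom : ∑ j ∈ Finset.Ico 2 (k + 1),
      (k.choose j : ℝ) * ((k : ℝ) / U.card) ^ j * Real.exp (s * j.choose 2) ≤ 1 := by
    calc _ ≤ ∑ j ∈ Finset.Ico 2 (k + 1), (3 / 5 : ℝ) ^ j :=
          Finset.sum_le_sum fun j hj => choose_mul_div_pow_mul_exp_le (Finset.mem_Ico.1 hj).1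
            (Nat.le_of_lt_succ (Finset.mem_Ico.1 hj).2) hU hs
      _ ≤ (3 / 5) ^ 2 / (1 - 3 / 5) := geom_sum_Ico_le_of_lt_one (by norm_num) (by norm_num)
      _ ≤ 1 := by norm_num
  refine (sum_card_inter_le hVU rfl (g := fun j => Real.exp (s * j.choose 2))
    (fun _ => (Real.exp_pos _).le) (by simp) (by simp)).trans ?_
  gcongr
  linarith

end Estimates

section CliqueRisk

variable {m k : ℕ} {μ : ℝ}

theorem half_le_bayesRisk_cliqueClass (hk : 1 ≤ k) (hkm : 10 * k ^ 2 ≤ 3 * m)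
    (hμ : μ ^ 2 ≤ 1 / k * Real.log (m / (2 * k))) :
    1 / 2 ≤ bayesRisk (cliqueClass m k) μ := by
  classical
  refine half_le_bayesRisk_of_sum_exp_card_inter_le (cliqueClass_nonempty (by nlinarith))
    fun S hS => ?_
  rcases hk.eq_or_lt with rfl | hk2
  · have hempty : S = ∅ := Finset.card_eq_zero.1 (card_of_mem_cliqueClass hS)
    simp only [hempty, Finset.empty_inter, Finset.card_empty, Nat.cast_zero, mul_zero,
      Real.exp_zero, Finset.sum_const, nsmul_eq_mul, mul_one]
    linarith [(Nat.cast_nonneg (cliqueClass m 1).card : (0 : ℝ) ≤ _)]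
  · rw [card_cliqueClass hk2]
    rw [cliqueClass_eq_image_powersetCard] at hS ⊢
    obtain ⟨V, hV, rfl⟩ := Finset.mem_image.1 hS
    obtain ⟨-, rfl⟩ := Finset.mem_powersetCard.1 hV
    rw [Finset.sum_image (injOn_edgesWithin_powersetCard hk2)]
    simp only [edgesWithin_inter, card_edgesWithin]
    simpa using sum_exp_mul_card_inter_choose_two_le V.subset_univ (by simpa using hkm)
      (by simpa using hμ)

theorem bayesRisk_cliqueClass_le (hk : 2 ≤ k) (hkm : k ≤ m) {δ : ℝ} (hδ : 0 < δ) (hδ2 : δ ≤ 2)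
    (hμ : 2 * √(1 / ((k : ℝ) - 1) * Real.log (m * Real.exp 1 / k)) +
      4 * √(Real.log (2 / δ) / (k * ((k : ℝ) - 1))) ≤ μ) :
    bayesRisk (cliqueClass m k) μ ≤ δ := by
  have hk1 : (0 : ℝ) < k - 1 := by
    have : (2 : ℝ) ≤ k := by exact_mod_cast hk
    linarith
  have hchoose : (0 : ℝ) < m.choose k := by exact_mod_cast Nat.choose_pos hkm
  have hlog : Real.log (m.choose k) ≤ k * Real.log (m * Real.exp 1 / k) := by
    rw [← Real.log_pow]
    exact Real.log_le_log hchoose (choose_le_exp_mul_div_pow m k)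
  refine bayesRisk_le_of_card_eq (cliqueClass_nonempty hkm) (Nat.choose_pos hk)
    (fun S hS => card_of_mem_cliqueClass hS) hδ hδ2 (le_trans ?_ hμ)
  have hdouble (x y : ℝ) : √(2 * x / (y / 2)) = 2 * √(x / y) := by
    rw [show 2 * x / (y / 2) = 2 ^ 2 * (x / y) by ring, Real.sqrt_mul (by positivity),
      Real.sqrt_sq zero_le_two]
  have hsignal : √(Real.log (m.choose k) / (k * (k - 1))) ≤
      √(1 / (k - 1) * Real.log (m * Real.exp 1 / k)) := by
    refine Real.sqrt_le_sqrt ((div_le_iff₀ (by positivity)).2 (hlog.trans_eq ?_))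
    field_simp
  rw [card_cliqueClass hk, Nat.cast_choose_two, hdouble, hdouble]
  linarith

end CliqueRisk

lemma ten_mul_sq_le_of_le_sqrt {m k : ℕ} (hkm : (k : ℝ) ≤ √(m * Real.log 2 / Real.exp 1)) :
    10 * k ^ 2 ≤ 3 * m := by
  have hratio : Real.log 2 / Real.exp 1 ≤ 3 / 10 := by
    rw [div_le_iff₀ (Real.exp_pos 1)]
    linarith [Real.log_two_lt_d9, Real.exp_one_gt_d9]
  have hsq : (k : ℝ) ^ 2 ≤ m * (Real.log 2 / Real.exp 1) := by
    rw [← mul_div_assoc]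
    exact (Real.le_sqrt (Nat.cast_nonneg k) (by positivity)).1 hkm
  have hsq' : (10 : ℝ) * k ^ 2 ≤ 3 * m := by
    nlinarith [mul_le_mul_of_nonneg_left hratio (Nat.cast_nonneg (α := ℝ) m)]
  exact_mod_cast hsq'

end CliqueTesting

theorem mainTheorem7_general (m k : ℕ) :
    (2 ≤ k → k ≤ m → ∀ δ : ℝ, 0 < δ → δ ≤ 2 → ∀ μ : ℝ,
      2 * Real.sqrt (1 / ((k : ℝ) - 1) * Real.log ((m : ℝ) * Real.exp 1 / (k : ℝ)))
          + 4 * Real.sqrt (Real.log (2 / δ) / ((k : ℝ) * ((k : ℝ) - 1))) ≤ μ →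
        CliqueTesting.bayesRisk (CliqueTesting.cliqueClass m k) μ ≤ δ) ∧
    (1 ≤ k → 10 * k ^ 2 ≤ 3 * m → ∀ μ : ℝ,
      μ ^ 2 ≤ 1 / (k : ℝ) * Real.log ((m : ℝ) / (2 * (k : ℝ))) →
        1 / 2 ≤ CliqueTesting.bayesRisk (CliqueTesting.cliqueClass m k) μ) :=
  ⟨fun hk hkm _ hδ hδ2 _ hμ => CliqueTesting.bayesRisk_cliqueClass_le hk hkm hδ hδ2 hμ,
    fun hk hkm _ hμ => CliqueTesting.half_le_bayesRisk_cliqueClass hk hkm hμ⟩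

theorem mainTheorem7 (m k : ℕ) (hk : 1 ≤ k)
    (hkm : (k : ℝ) ≤ Real.sqrt ((m : ℝ) * Real.log 2 / Real.exp 1)) :
    (2 ≤ k → ∀ δ : ℝ, 0 < δ → δ < 1 → ∀ μ : ℝ, 0 < μ →
      2 * Real.sqrt (1 / ((k : ℝ) - 1) * Real.log ((m : ℝ) * Real.exp 1 / (k : ℝ)))
          + 4 * Real.sqrt (Real.log (2 / δ) / ((k : ℝ) * ((k : ℝ) - 1))) ≤ μ →
        CliqueTesting.bayesRisk (CliqueTesting.cliqueClass m k) μ ≤ δ) ∧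
    (∀ μ : ℝ, 0 < μ →
      μ ≤ Real.sqrt (1 / (k : ℝ) * Real.log ((m : ℝ) / (2 * (k : ℝ)))) →
        1 / 2 ≤ CliqueTesting.bayesRisk (CliqueTesting.cliqueClass m k) μ) := by
  have hsq := CliqueTesting.ten_mul_sq_le_of_le_sqrt hkm
  obtain ⟨hupper, hlower⟩ := mainTheorem7_general m k
  exact ⟨fun hk2 δ hδ hδ1 μ _ => hupper hk2 (by nlinarith) δ hδ (by linarith) μ,
    fun μ hμ0 hμ => hlower hk hsq μ ((Real.le_sqrt' hμ0).1 hμ)⟩
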